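/- Let $X$ be a standard Borel space and let $\mu$ be a non-atomic $\sigma$-finite (finite or infinite) measure on $X$, that is, $\mu(\{x\})=0$ for every $x\in X$. Let $\mathrm{Aut}(X,\mu)$ be the group of all measure-preserving automorphisms of $(X,\mu)$ (bijections $T\colon X\to X$ such that $T$ and $T^{-1}$ are measurable and preserve $\mu$), two automorphisms being identified when they agree $\mu$-almost everywhere. Equip $\mathrm{Aut}(X,\mu)$ with the strong topology, i.e. the topology induced, through the unitary representation $\Phi(T)f=f\circ T^{-1}$ of $\mathrm{Aut}(X,\mu)$ on $L^2(X,\mu)$, by the strong operator topology. Then the topological group $\mathrm{Aut}(X,\mu)$ is extremely amenable: every continuous action $\mathrm{Aut}(X,\mu)\times K\to K$ on a nonempty compact Hausdorff space $K$ has a fixed point. -/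

import Mathlib

open MeasureTheory

universe u v

/-- A topological group `G` is extremely amenable (has the fixed point on compacta property) if
every (jointly) continuous action of `G` on a nonempty compact Hausdorff space `K` has a fixed
point. The space `K` ranges over an arbitrary universe `v`. -/
def IsExtremelyAmenable (G : Type u) [Group G] [TopologicalSpace G]
    [IsTopologicalGroup G] : Prop :=
  ∀ (K : Type v) [TopologicalSpace K] [CompactSpace K] [T2Space K] [Nonempty K]
    [MulAction G K] [ContinuousSMul G K], ∃ x : K, ∀ g : G, g • x = x

namespace MeasureAut

/-- The group (under composition) of all bijections `T` of `X` onto itself such that `T` and `T⁻¹`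
are measurable and preserve `μ`. -/
def pointwiseGroup {X : Type*} [MeasurableSpace X] (μ : Measure X) :
    Subgroup (Equiv.Perm X) where
  carrier := {T | MeasurePreserving T μ μ ∧ MeasurePreserving T.symm μ μ}
  one_mem' := ⟨MeasurePreserving.id μ, MeasurePreserving.id μ⟩
  mul_mem' := fun hS hT => ⟨hS.1.comp hT.1, hT.2.comp hS.2⟩
  inv_mem' := fun hT => ⟨hT.2, hT.1⟩

/-- The normal subgroup of the automorphisms that are equal to the identity `μ`-almost
everywhere. -/
def nullSubgroup {X : Type*} [MeasurableSpace X] (μ : Measure X) :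
    Subgroup (pointwiseGroup μ) where
  carrier := {T | ∀ᵐ x ∂μ, (T : Equiv.Perm X) x = x}
  one_mem' := by
    change ∀ᵐ x ∂μ, (1 : Equiv.Perm X) x = x
    exact Filter.Eventually.of_forall fun _ => rfl
  mul_mem' := by
    intro S T hS hT
    have hT' : ∀ᵐ x ∂μ, (T : Equiv.Perm X) x = x := hT
    have hS' : ∀ᵐ x ∂μ, (S : Equiv.Perm X) x = x := hS
    change ∀ᵐ x ∂μ, (S : Equiv.Perm X) ((T : Equiv.Perm X) x) = x
    filter_upwards [hT', hS'] with x h1 h2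
    rw [h1, h2]
  inv_mem' := by
    intro T hT
    have hT' : ∀ᵐ x ∂μ, (T : Equiv.Perm X) x = x := hT
    change ∀ᵐ x ∂μ, (T : Equiv.Perm X).symm x = x
    filter_upwards [hT'] with x h
    rw [Equiv.symm_apply_eq, h]

instance nullSubgroup_normal {X : Type*} [MeasurableSpace X] (μ : Measure X) :
    (nullSubgroup μ).Normal where
  conj_mem := by
    intro T hT S
    have hT' : ∀ᵐ x ∂μ, (T : Equiv.Perm X) x = x := hT
    have h := S.2.2.quasiMeasurePreserving.ae hT'
    change ∀ᵐ x ∂μ, (S : Equiv.Perm X) ((T : Equiv.Perm X) ((S : Equiv.Perm X).symm x)) = x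
    filter_upwards [h] with x hx
    rw [hx, Equiv.apply_symm_apply]

end MeasureAut

/-- `Aut(X, μ)`: the group of all measure-preserving automorphisms of `(X, μ)`, where two
automorphisms that agree `μ`-almost everywhere are identified. -/
def MeasureAut {X : Type*} [MeasurableSpace X] (μ : Measure X) : Type _ :=
  MeasureAut.pointwiseGroup μ ⧸ MeasureAut.nullSubgroup μ

namespace MeasureAut

instance instGroup {X : Type*} [MeasurableSpace X] (μ : Measure X) : Group (MeasureAut μ) :=
  inferInstanceAs (Group (pointwiseGroup μ ⧸ nullSubgroup μ))

/-- The unitary operator `f ↦ f ∘ T⁻¹` of the complex Hilbert space `L²(X, μ)`, as a homomorphism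
in `T`. (The Radon-Nikodym factor `dμ ∘ T⁻¹ / dμ` is `1`, because `T` preserves `μ`.) -/
noncomputable def koopmanAux {X : Type*} [MeasurableSpace X] (μ : Measure X) :
    pointwiseGroup μ →* (Lp ℂ 2 μ ≃ₗᵢ[ℂ] Lp ℂ 2 μ) where
  toFun T :=
    { toLinearEquiv := LinearEquiv.ofLinearMap
        (Lp.compMeasurePreservingₗ ℂ (T : Equiv.Perm X).symm T.2.2)
        (Lp.compMeasurePreservingₗ ℂ (T : Equiv.Perm X) T.2.1)
        (by
          ext1 f
          change Lp.compMeasurePreserving _ T.2.2 (Lp.compMeasurePreserving _ T.2.1 f) = f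
          rw [← Lp.compMeasurePreserving_comp_apply]
          simp only [Equiv.self_comp_symm]
          exact Lp.compMeasurePreserving_id_apply f)
        (by
          ext1 f
          change Lp.compMeasurePreserving _ T.2.1 (Lp.compMeasurePreserving _ T.2.2 f) = f
          rw [← Lp.compMeasurePreserving_comp_apply]
          simp only [Equiv.symm_comp_self]
          exact Lp.compMeasurePreserving_id_apply f)
      norm_map' := fun f => Lp.norm_compMeasurePreserving f T.2.2 }
  map_one' := by
    ext1 f
    exact Lp.compMeasurePreserving_id_apply f
  map_mul' S T := by
    ext1 f
    exact Lp.compMeasurePreserving_comp_apply f T.2.2 S.2.2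

theorem koopmanAux_apply {X : Type*} [MeasurableSpace X] (μ : Measure X)
    (T : pointwiseGroup μ) (f : Lp ℂ 2 μ) :
    koopmanAux μ T f = Lp.compMeasurePreserving (T : Equiv.Perm X).symm T.2.2 f := rfl

theorem koopmanAux_eq_one {X : Type*} [MeasurableSpace X] (μ : Measure X)
    (T : pointwiseGroup μ) (hT : T ∈ nullSubgroup μ) : koopmanAux μ T = 1 := by
  have h : ∀ᵐ x ∂μ, (T : Equiv.Perm X).symm x = x := (nullSubgroup μ).inv_mem hT
  ext1 f
  rw [koopmanAux_apply]
  apply Lp.ext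
  filter_upwards [Lp.coeFn_compMeasurePreserving f T.2.2, h] with x h1 h2
  rw [h1, Function.comp_apply, h2]
  rfl

/-- The unitary representation `Φ` of `Aut(X, μ)` on `L²(X, μ)`, `Φ(T) f = f ∘ T⁻¹`. -/
noncomputable def koopman {X : Type*} [MeasurableSpace X] (μ : Measure X) :
    MeasureAut μ →* (Lp ℂ 2 μ ≃ₗᵢ[ℂ] Lp ℂ 2 μ) :=
  QuotientGroup.lift (nullSubgroup μ) (koopmanAux μ) (koopmanAux_eq_one μ)

/-- The strong topology on `Aut(X, μ)`: the topology induced through `Φ` by the strong operator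
topology, that is, by pointwise (norm) convergence of operators on `L²(X, μ)`. -/
noncomputable instance instTopologicalSpace {X : Type*} [MeasurableSpace X] (μ : Measure X) :
    TopologicalSpace (MeasureAut μ) :=
  TopologicalSpace.induced (fun (T : MeasureAut μ) (f : Lp ℂ 2 μ) => koopman μ T f)
    Pi.topologicalSpace

theorem continuous_koopman_apply {X : Type*} [MeasurableSpace X] (μ : Measure X)
    (f : Lp ℂ 2 μ) : Continuous fun T : MeasureAut μ => koopman μ T f :=
  (continuous_apply f).comp continuous_induced_dom

/-- `Aut(X, μ)` with the strong topology is a topological group. -/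
instance instIsTopologicalGroup {X : Type*} [MeasurableSpace X] (μ : Measure X) :
    IsTopologicalGroup (MeasureAut μ) where
  continuous_mul := by
    refine continuous_induced_rng.2 (continuous_pi fun f => ?_)
    refine continuous_iff_continuousAt.2 fun p => ?_
    obtain ⟨S₀, T₀⟩ := p
    refine tendsto_iff_dist_tendsto_zero.2 ?_
    have h1 : Filter.Tendsto (fun p : MeasureAut μ × MeasureAut μ =>
        dist (koopman μ p.2 f) (koopman μ T₀ f) +
          dist (koopman μ p.1 (koopman μ T₀ f)) (koopman μ S₀ (koopman μ T₀ f)))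
        (nhds (S₀, T₀)) (nhds 0) := by
      have hc : Continuous (fun p : MeasureAut μ × MeasureAut μ =>
          dist (koopman μ p.2 f) (koopman μ T₀ f) +
            dist (koopman μ p.1 (koopman μ T₀ f)) (koopman μ S₀ (koopman μ T₀ f))) :=
        (((continuous_koopman_apply μ f).comp continuous_snd).dist continuous_const).add
          (((continuous_koopman_apply μ _).comp continuous_fst).dist continuous_const)
      simpa using hc.tendsto (S₀, T₀)
    refine squeeze_zero (fun _ => dist_nonneg) (fun p => ?_) h1
    simp only [Function.comp_apply, map_mul, LinearIsometryEquiv.coe_mul]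
    refine (dist_triangle _ (koopman μ p.1 (koopman μ T₀ f)) _).trans ?_
    rw [LinearIsometryEquiv.dist_map]
  continuous_inv := by
    refine continuous_induced_rng.2 (continuous_pi fun f => ?_)
    refine continuous_iff_continuousAt.2 fun T₀ => ?_
    refine tendsto_iff_dist_tendsto_zero.2 ?_
    have h1 : Filter.Tendsto (fun T : MeasureAut μ =>
        dist (koopman μ T₀ (koopman μ T₀⁻¹ f)) (koopman μ T (koopman μ T₀⁻¹ f)))
        (nhds T₀) (nhds 0) := by
      have hc : Continuous (fun T : MeasureAut μ =>
          dist (koopman μ T₀ (koopman μ T₀⁻¹ f)) (koopman μ T (koopman μ T₀⁻¹ f))) :=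
        continuous_const.dist (continuous_koopman_apply μ (koopman μ T₀⁻¹ f))
      have h := hc.tendsto T₀
      rwa [dist_self] at h
    refine h1.congr fun T => ?_
    have e : ∀ S : MeasureAut μ, ∀ g, koopman μ S (koopman μ S⁻¹ g) = g := by
      intro S g
      have h : koopman μ S * koopman μ S⁻¹ = 1 := by rw [← map_mul, mul_inv_cancel, map_one]
      exact congrArg (fun U : Lp ℂ 2 μ ≃ₗᵢ[ℂ] Lp ℂ 2 μ => U g) h
    rw [e T₀ f]
    nth_rewrite 1 [← e T f]
    rw [LinearIsometryEquiv.dist_map]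
    rfl

end MeasureAut

/-! By compactness of $K$, a fixed point exists once, for any finitely many pairs $(g,f)$ with $g$
an automorphism and $f\in C(K)$, some point $x$ satisfies $|f(gx)-f(x)|\le\varepsilon$ for all of
them. Uniform continuity of the action gives a neighbourhood $V$ of $1$ whose elements change each
$f$ by less than $\varepsilon/4$ everywhere on $K$.

Symmetric groups supply the point. Cut a set of finite measure into $n$ blocks of equal small
measure $c$, with $cn\le C$; permuting the blocks embeds $S_n$ in the group. By weak approximation
(`exists_perm_approx`) each given $g$ has a $\tau\in S_n$ with $g\rho(\tau)\in V$, so $g$ may be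
replaced by $\rho(\tau^{-1})$.

Fix $x_0$ and consider $\sigma\mapsto f(\rho(\sigma)x_0)$ on $S_n$. It varies little on balls of a
fixed radius $\delta$ for the metric $c\cdot$Hamming, so it is uniformly close to a function with
Lipschitz constant $M$ independent of $n$ and $c$ (`exists_lipschitz_approx`). A transposition
changes that function by at most $2Mc$, so its variance is at most $n(2Mc)^2\le 4M^2Cc$
(`perm_variance_le`), which tends to $0$ with $c$. A function of small variance is close to its
translates in mean square, so averaging yields one $\sigma$ good for all pairs, and
$x=\rho(\sigma)x_0$ is almost fixed. Second moments thus suffice for the concentration of measure.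
-/

/-! ### Variance on symmetric groups -/

/-- The mean value of a real function on a finite type. -/
noncomputable def finMean {β : Type*} [Fintype β] (f : β → ℝ) : ℝ :=
  (∑ x, f x) / Fintype.card β

/-- The cross term vanishes because deviations from the mean sum to zero. -/
theorem sum_sq_sub_eq_sum_sq_sub_finMean {β : Type*} [Fintype β] [Nonempty β] (f : β → ℝ)
    (a : ℝ) : ∑ x, (f x - a) ^ 2 =
      ∑ x, (f x - finMean f) ^ 2 + Fintype.card β * (finMean f - a) ^ 2 := by
  have hN : (Fintype.card β : ℝ) ≠ 0 := by exact_mod_cast Fintype.card_ne_zero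
  have hm : ∑ x, f x = Fintype.card β * finMean f := by rw [finMean]; field_simp
  have e : ∀ b : ℝ, ∑ x, (f x - b) ^ 2 =
      ∑ x, f x ^ 2 - 2 * b * (Fintype.card β * finMean f) + Fintype.card β * b ^ 2 := by
    intro b
    rw [← hm]
    simp only [sub_sq, Finset.sum_add_distrib, Finset.sum_sub_distrib, Finset.sum_const,
      Finset.card_univ, nsmul_eq_mul, ← Finset.sum_mul, ← Finset.mul_sum]
    ring
  rw [e, e]
  ring

theorem sum_sq_sub_finMean_le {β : Type*} [Fintype β] [Nonempty β] (f : β → ℝ) (a : ℝ) :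
    ∑ x, (f x - finMean f) ^ 2 ≤ ∑ x, (f x - a) ^ 2 := by
  rw [sum_sq_sub_eq_sum_sq_sub_finMean f a]
  exact le_add_of_nonneg_right (by positivity)

theorem abs_finMean_sub_le {β : Type*} [Fintype β] [Nonempty β] (f g : β → ℝ) {K : ℝ}
    (h : ∀ x, |f x - g x| ≤ K) : |finMean f - finMean g| ≤ K := by
  have hN : (0 : ℝ) < Fintype.card β := by exact_mod_cast Fintype.card_pos
  rw [finMean, finMean, ← sub_div, abs_div, abs_of_pos hN, div_le_iff₀ hN,
    ← Finset.sum_sub_distrib]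
  refine (Finset.abs_sum_le_sum_abs _ _).trans ?_
  refine (Finset.sum_le_sum fun x _ => h x).trans ?_
  simp [mul_comm]

/-- The variance of a function on the symmetric group that changes by at most `K` under every
transposition is at most `n * K ^ 2`. -/
theorem perm_variance_le (α : Type*) [Fintype α] : ∀ [DecidableEq α] (f : Equiv.Perm α → ℝ)
    (K : ℝ), (∀ a b σ, |f (Equiv.swap a b * σ) - f σ| ≤ K) →
    ∑ σ, (f σ - finMean f) ^ 2 ≤
      Fintype.card (Equiv.Perm α) * (Fintype.card α * K ^ 2) := by
  classical
  refine Fintype.induction_empty_option (P := fun α _ => ∀ [DecidableEq α]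
    (f : Equiv.Perm α → ℝ) (K : ℝ), (∀ a b σ, |f (Equiv.swap a b * σ) - f σ| ≤ K) →
    ∑ σ, (f σ - finMean f) ^ 2 ≤
      Fintype.card (Equiv.Perm α) * (Fintype.card α * K ^ 2)) ?_ ?_ ?_ α
  -- Conjugation by `e` carries transpositions to transpositions and preserves the mean.
  · intro α β instβ e ih instd f K hf
    let _ := Fintype.ofEquiv β e.symm
    let E : Equiv.Perm α ≃ Equiv.Perm β := e.permCongr
    have h := ih (f ∘ E) K (fun a b σ => by
      have : E (Equiv.swap a b * σ) = Equiv.swap (e a) (e b) * E σ := by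
        ext x
        simp [E, Equiv.permCongr_apply, Equiv.swap_apply_def, ← Equiv.eq_symm_apply]
        split_ifs <;> simp
      simp only [Function.comp_apply, this]
      exact hf _ _ _)
    have hm : finMean (f ∘ E) = finMean f := by
      simp only [finMean, Function.comp_apply, Equiv.sum_comp E f, Fintype.card_congr E]
    rw [hm, Fintype.card_congr E, Fintype.card_congr e] at h
    refine le_trans (le_of_eq ?_) h
    exact (Equiv.sum_comp E fun σ => (f σ - finMean f) ^ 2).symm
  · intro _ f K _
    have : finMean f = f 1 := by simp [finMean, Subsingleton.elim default (1 : Equiv.Perm PEmpty.{_ + 1})]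
    have h2 : ∀ σ, f σ = f 1 := fun σ => by rw [Subsingleton.elim σ 1]
    simp [this, h2]
  · intro α _ ih inst f K hf
    obtain rfl : inst = (fun a b => Option.instDecidableEq a b) := Subsingleton.elim _ _
    -- `F i` is `f` restricted to the permutations sending `none` to `i`, a coset of the stabilizer
    -- of `none`.
    let F : Option α → Equiv.Perm α → ℝ := fun i σ => f (Equiv.swap none i * σ.optionCongr)
    have hF : ∀ g : Equiv.Perm (Option α) → ℝ,
        ∑ σ, g σ = ∑ i, ∑ σ : Equiv.Perm α, g (Equiv.swap none i * σ.optionCongr) := by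
      intro g
      rw [← Fintype.sum_prod_type', ← Equiv.sum_comp (Equiv.Perm.decomposeOption (α := α)).symm]
      rfl
    have hV : ∀ i, ∑ σ, (F i σ - finMean (F i)) ^ 2 ≤
        Fintype.card (Equiv.Perm α) * (Fintype.card α * K ^ 2) := by
      intro i
      refine ih (F i) K fun a b σ => ?_
      -- A conjugate of a transposition is a transposition, so `F i` inherits the bound `K`.
      have : Equiv.swap none i * (Equiv.swap a b * σ).optionCongr =
          Equiv.swap (Equiv.swap none i (some a)) (Equiv.swap none i (some b)) *
            (Equiv.swap none i * σ.optionCongr) := by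
        rw [← mul_assoc, ← Equiv.mul_swap_eq_swap_mul, mul_assoc, ← Equiv.optionCongr_swap]
        congr 1
        exact Equiv.optionCongr_trans σ (Equiv.swap a b)
      simp only [F, this]
      exact hf _ _ _
    have hM : ∀ i, |finMean (F i) - finMean (F none)| ≤ K := fun i =>
      abs_finMean_sub_le _ _ fun σ => by
        have h := hf none i σ.optionCongr
        simp only [F, Equiv.swap_self]
        exact h
    have hc : Fintype.card (Equiv.Perm (Option α)) =
        Fintype.card (Option α) * Fintype.card (Equiv.Perm α) := by
      rw [Fintype.card_congr (Equiv.Perm.decomposeOption (α := α)), Fintype.card_prod]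
    -- Around the mean of `F none`, each coset contributes its own variance plus the squared shift
    -- of its mean, at most `K ^ 2` per element. This is the increment from `n` to `n + 1`.
    calc _ ≤ ∑ σ, (f σ - finMean (F none)) ^ 2 := sum_sq_sub_finMean_le _ _
      _ = ∑ i, ∑ σ, (F i σ - finMean (F none)) ^ 2 := hF _
      _ ≤ ∑ i : Option α, (Fintype.card (Equiv.Perm α) * (Fintype.card α * K ^ 2) +
            Fintype.card (Equiv.Perm α) * K ^ 2) := by
          refine Finset.sum_le_sum fun i _ => ?_
          rw [sum_sq_sub_eq_sum_sq_sub_finMean]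
          have := sq_le_sq' (neg_le_of_abs_le (hM i)) (le_of_abs_le (hM i))
          gcongr
          exact hV i
      _ = _ := by
          rw [hc, Finset.sum_const, Finset.card_univ, nsmul_eq_mul, Fintype.card_option]
          push_cast
          ring

/-! ### Regularization and matching on finite sets -/

/-- Lipschitz regularization (infimal convolution) with respect to a bounded-range distance. -/
theorem exists_lipschitz_approx {β : Type*} [Fintype β] (d : β → β → ℝ)
    (d_nonneg : ∀ x y, 0 ≤ d x y) (d_self : ∀ x, d x x = 0)
    (d_tri : ∀ x y z, d x z ≤ d x y + d y z) (f : β → ℝ) {B δ ε : ℝ} (hδ : 0 < δ)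
    (hB : ∀ x, |f x| ≤ B) (hε : 0 ≤ ε) (hf : ∀ x y, d x y < δ → |f x - f y| ≤ ε) :
    ∃ g : β → ℝ, (∀ x, |g x - f x| ≤ ε) ∧ ∀ x y, g x - g y ≤ 2 * B / δ * d x y := by
  classical
  rcases isEmpty_or_nonempty β with hE | hE
  · exact ⟨f, fun x => (hE.false x).elim, fun x => (hE.false x).elim⟩
  have hB0 : 0 ≤ B := (abs_nonneg _).trans (hB hE.some)
  have hM : 0 ≤ 2 * B / δ := by positivity
  -- With slope `2 * B / δ` the penalty beyond distance `δ` is at least `2 * B`, which outweighs the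
  -- oscillation of `f`; only points closer than `δ` can lower the infimum.
  let F : β → β → ℝ := fun x y => f y + 2 * B / δ * d x y
  let g : β → ℝ := fun x => Finset.univ.inf' Finset.univ_nonempty (F x)
  have hg : ∀ x, ∃ y, g x = F x y := fun x => by
    obtain ⟨y, -, hy⟩ := Finset.exists_mem_eq_inf' Finset.univ_nonempty (F x)
    exact ⟨y, hy⟩
  have hle : ∀ x y, g x ≤ F x y := fun x y => Finset.inf'_le _ (Finset.mem_univ y)
  refine ⟨g, fun x => ?_, fun x y => ?_⟩
  · have h1 : g x ≤ f x := by simpa [F, d_self] using hle x x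
    obtain ⟨y, hy⟩ := hg x
    rw [abs_le]
    refine ⟨?_, by linarith⟩
    rw [hy]
    rcases lt_or_ge (d x y) δ with h | h
    · have := (abs_le.1 (hf x y h)).2
      have := mul_nonneg hM (d_nonneg x y)
      simp only [F]
      linarith
    · have h3 : 2 * B ≤ 2 * B / δ * d x y := by
        calc 2 * B = 2 * B / δ * δ := by field_simp
          _ ≤ _ := by gcongr
      have := (abs_le.1 (hB x)).2
      have := (abs_le.1 (hB y)).1
      simp only [F]
      linarith
  · obtain ⟨z, hz⟩ := hg y
    have h1 := hle x z
    have h2 := mul_le_mul_of_nonneg_left (d_tri x y z) hM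
    rw [hz]
    simp only [F] at h1 ⊢
    linarith

/-- Two colourings of a finite set can be matched by a permutation, up to the differences of the
sizes of the colour classes. -/
theorem exists_perm_matching {ι κ : Type*} [Fintype ι] [DecidableEq κ] (a b : ι → κ) :
    ∃ σ : Equiv.Perm ι, ∀ k, min (Finset.univ.filter fun i => a i = k).card
      (Finset.univ.filter fun i => b i = k).card ≤
        (Finset.univ.filter fun i => a i = k ∧ b (σ i) = k).card := by
  classical
  -- Take `σ` with the most matches. If colour `k` fell short, there would be an unmatched `i` of
  -- colour `k` and a `j` of another colour with `b (σ j) = k`; exchanging their images gains a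
  -- match at `i` and loses none.
  obtain ⟨σ, hσ⟩ := Finite.exists_max
    fun σ : Equiv.Perm ι => (Finset.univ.filter fun i => a i = b (σ i)).card
  refine ⟨σ, fun k => ?_⟩
  by_contra! hlt
  obtain ⟨h1, h2⟩ := lt_min_iff.1 hlt
  obtain ⟨i, hi, hi'⟩ := Finset.exists_mem_notMem_of_card_lt_card h1
  have h2' : (Finset.univ.filter fun i => a i = k ∧ b (σ i) = k).card <
      (Finset.univ.filter fun i => b (σ i) = k).card := by
    refine h2.trans_eq ?_
    refine (Finset.card_bij (fun i _ => σ i) (by simp) (by simp) fun j hj => ?_).symm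
    exact ⟨σ.symm j, by simpa using hj, by simp⟩
  obtain ⟨j, hj, hj'⟩ := Finset.exists_mem_notMem_of_card_lt_card h2'
  simp only [Finset.mem_filter, Finset.mem_univ, true_and, not_and] at hi hi' hj hj'
  have hbi := hi' hi
  have haj : a j ≠ k := fun h => hj' h hj
  refine absurd (hσ (σ * Equiv.swap i j)) (not_le.2 (Finset.card_lt_card ?_))
  refine Finset.ssubset_iff_of_subset (fun l hl => ?_) |>.2 ⟨i, ?_, ?_⟩
  · simp only [Finset.mem_filter, Finset.mem_univ, true_and] at hl ⊢
    rw [Equiv.Perm.mul_apply]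
    have hli : l ≠ i := by rintro rfl; exact hbi (hl ▸ hi)
    have hlj : l ≠ j := by rintro rfl; exact haj (hl.trans hj)
    rwa [Equiv.swap_apply_of_ne_of_ne hli hlj]
  · simp only [Finset.mem_filter, Finset.mem_univ, true_and]
    rw [Equiv.Perm.mul_apply, Equiv.swap_apply_left, hi, hj]
  · simp only [Finset.mem_filter, Finset.mem_univ, true_and]
    exact fun h => hbi (h ▸ hi)

/-! ### Non-atomic measures and Lebesgue measure -/

open Set Filter Topology in
-- An increment near `b` is at most the mass of a closed interval shrinking to `b`, which tends to
-- the mass of `{b}`, namely zero.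
theorem continuous_measureReal_Iic (ν : Measure ℝ) [IsFiniteMeasure ν] [NullSingletonClass ν] :
    Continuous fun x => ν.real (Iic x) := by
  refine continuous_iff_continuousAt.2 fun b => tendsto_iff_dist_tendsto_zero.2 ?_
  have h1 : Tendsto (fun x : ℝ => |x - b|) (𝓝 b) (𝓝 0) := by
    have : Continuous fun x : ℝ => |x - b| := by fun_prop
    simpa using this.tendsto b
  have h2 := (ENNReal.tendsto_toReal ENNReal.zero_ne_top).comp
    ((tendsto_measure_Icc ν b).comp h1)
  refine squeeze_zero (fun _ => dist_nonneg) (fun x => ?_) h2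
  have key : ∀ u v : ℝ, u ≤ v → Icc u v ⊆ Icc (b - |x - b|) (b + |x - b|) →
      |ν.real (Iic v) - ν.real (Iic u)| ≤ ν.real (Icc (b - |x - b|) (b + |x - b|)) := by
    intro u v huv hs
    have hsub : Iic u ⊆ Iic v := Iic_subset_Iic.2 huv
    rw [abs_of_nonneg (sub_nonneg.2 (measureReal_mono hsub)),
      ← measureReal_sdiff hsub measurableSet_Iic]
    refine measureReal_mono (Subset.trans (fun y hy => ?_) hs)
    exact ⟨(not_le.1 hy.2).le, hy.1⟩
  rw [Real.dist_eq]
  rcases le_total x b with h | h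
  · rw [abs_sub_comm]
    refine key x b h (Icc_subset_Icc ?_ ?_) <;> rw [abs_of_nonpos (by linarith)] <;> linarith
  · refine key b x h (Icc_subset_Icc ?_ ?_) <;> rw [abs_of_nonneg (by linarith)] <;> linarith

open Set Filter Topology in
/-- The probability integral transform for a finite measure without atoms. -/
theorem map_measureReal_Iic (ν : Measure ℝ) [IsFiniteMeasure ν] [NullSingletonClass ν] :
    ν.map (fun x => ν.real (Iic x)) = volume.restrict (Ioc 0 (ν.real univ)) := by
  have hF := continuous_measureReal_Iic ν
  set F : ℝ → ℝ := fun x => ν.real (Iic x) with hFdef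
  have hmono : Monotone F := fun x y h => measureReal_mono (Iic_subset_Iic.2 h)
  have hm0 : 0 ≤ ν.real univ := measureReal_nonneg
  have htop : Tendsto F atTop (𝓝 (ν.real univ)) :=
    (ENNReal.tendsto_toReal (measure_ne_top ν _)).comp (tendsto_measure_Iic_atTop ν)
  have hbot : Tendsto F atBot (𝓝 0) := by
    have h := tendsto_measure_iInter_atBot (μ := ν) (s := fun x : ℝ => Iic x)
      (fun _ => measurableSet_Iic.nullMeasurableSet) (fun _ _ h => Iic_subset_Iic.2 h)
      ⟨0, measure_ne_top ν _⟩
    rw [iInter_Iic_eq_empty_iff.2 (by simpa using not_bddBelow_univ (α := ℝ)), measure_empty] at h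
    exact (ENNReal.tendsto_toReal ENNReal.zero_ne_top).comp h
  -- The sublevel set is a closed half-line `Iic s`, and continuity forces `F s = t`.
  have hmid : ∀ t, 0 < t → t < ν.real univ → ν {x | F x ≤ t} = ENNReal.ofReal t := by
    intro t h0 h1
    have hcl : IsClosed {x | F x ≤ t} := isClosed_le hF continuous_const
    obtain ⟨u, hu⟩ := ((hbot.eventually (gt_mem_nhds h0))).exists
    obtain ⟨v, hv⟩ := ((htop.eventually (lt_mem_nhds h1))).exists
    have hne : {x | F x ≤ t}.Nonempty := ⟨u, le_of_lt hu⟩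
    have hbd : BddAbove {x | F x ≤ t} := ⟨v, fun x hx => by
      by_contra! hlt
      exact absurd (hmono hlt.le) (not_le.2 (lt_of_le_of_lt hx hv))⟩
    set s := sSup {x | F x ≤ t}
    have hs : F s ≤ t := hcl.csSup_mem hne hbd
    have heq : {x | F x ≤ t} = Iic s := Subset.antisymm (fun x hx => le_csSup hbd hx)
      fun x hx => (hmono hx).trans hs
    have hst : F s = t := by
      refine le_antisymm hs (not_lt.1 fun hlt => ?_)
      have hev : ∀ᶠ x in 𝓝[>] s, F x < t :=
        nhdsWithin_le_nhds (hF.continuousAt.eventually (gt_mem_nhds hlt))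
      obtain ⟨x, hx, hxs⟩ := (hev.and self_mem_nhdsWithin).exists
      exact absurd (le_csSup hbd (show F x ≤ t from hx.le)) (not_le.2 hxs)
    rw [heq, ← hst, hFdef, ofReal_measureReal]
  have : IsFiniteMeasure (ν.map F) := inferInstance
  have : IsFiniteMeasure (volume.restrict (Ioc 0 (ν.real univ))) := by
    constructor; simp
  refine Measure.ext_of_Iic _ _ fun t => ?_
  rw [Measure.map_apply hF.measurable measurableSet_Iic, Measure.restrict_apply measurableSet_Iic]
  change ν {x | F x ≤ t} = _
  rcases le_or_gt (ν.real univ) t with h | h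
  · have h1 : {x | F x ≤ t} = univ :=
      eq_univ_of_forall fun x => (measureReal_mono (subset_univ _)).trans h
    have h2 : Iic t ∩ Ioc 0 (ν.real univ) = Ioc 0 (ν.real univ) :=
      inter_eq_right.2 fun x hx => hx.2.trans h
    rw [h1, h2, Real.volume_Ioc, sub_zero, ofReal_measureReal]
  · have h2 : Iic t ∩ Ioc 0 (ν.real univ) = Ioc 0 t := by
      ext x
      simp only [mem_inter_iff, mem_Iic, mem_Ioc]
      exact ⟨fun hx => ⟨hx.2.1, hx.1⟩, fun hx => ⟨hx.2, hx.1, hx.2.trans h.le⟩⟩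
    rw [h2, Real.volume_Ioc, sub_zero]
    rcases lt_trichotomy 0 t with h0 | h0 | h0
    · exact hmid t h0 h
    · subst h0
      -- The sublevel set at `0` may be empty, so its measure is bounded by that at small `s > 0`.
      rw [ENNReal.ofReal_zero, ← nonpos_iff_eq_zero]
      have hlim : Tendsto (fun s : ℝ => ENNReal.ofReal s) (𝓝[>] 0) (𝓝 0) := by
        have := (ENNReal.continuous_ofReal.tendsto (0 : ℝ)).mono_left
          (nhdsWithin_le_nhds (s := Ioi 0))
        simpa using this
      refine ge_of_tendsto hlim ?_
      filter_upwards [Ioo_mem_nhdsGT h] with s hs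
      rw [← hmid s hs.1 hs.2]
      exact measure_mono fun x hx => le_trans (show F x ≤ 0 from hx) hs.1.le
    · rw [ENNReal.ofReal_of_nonpos h0.le]
      have : {x | F x ≤ t} = ∅ := eq_empty_of_forall_notMem fun x hx =>
        absurd (measureReal_nonneg (μ := ν) (s := Iic x)) (not_le.2 (lt_of_le_of_lt hx h0))
      rw [this, measure_empty]

open Set in
/-- A finite measure without atoms on a standard Borel space is isomorphic, up to a null set, to
Lebesgue measure on an interval. -/
theorem exists_map_eq_volume {X : Type*} [MeasurableSpace X] [StandardBorelSpace X]
    (μ : Measure X) [IsFiniteMeasure μ] [NullSingletonClass μ] :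
    ∃ g : X → ℝ, Measurable g ∧ μ.map g = volume.restrict (Ioc 0 (μ.real univ)) ∧
      ∃ N : Set X, MeasurableSet N ∧ μ N = 0 ∧ InjOn g Nᶜ := by
  obtain ⟨f, hf⟩ := exists_measurableEmbedding_real X
  have hν : NullSingletonClass (μ.map f) := ⟨fun y => by
    rw [Measure.map_apply hf.measurable (measurableSet_singleton y)]
    exact (subsingleton_singleton.preimage hf.injective).measure_zero μ⟩
  have hmap := map_measureReal_Iic (μ.map f)
  have huniv : (μ.map f).real univ = μ.real univ := by
    rw [measureReal_def, Measure.map_apply hf.measurable MeasurableSet.univ, preimage_univ]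
    rfl
  have hF := (continuous_measureReal_Iic (μ.map f)).measurable
  have hmono : Monotone fun x => (μ.map f).real (Iic x) :=
    fun x y h => measureReal_mono (Iic_subset_Iic.2 h)
  set F : ℝ → ℝ := fun x => (μ.map f).real (Iic x)
  have hg : Measurable (F ∘ f) := hF.comp hf.measurable
  have hmg : μ.map (F ∘ f) = volume.restrict (Ioc 0 (μ.real univ)) := by
    rw [← Measure.map_map hF hf.measurable, hmap, huniv]
  -- Injectivity fails only where `F` is flat. Of two points with equal value, the right one has a
  -- rational to its left in the same flat piece; each such set lies in a fibre of `F ∘ f`, which is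
  -- null because the image measure is Lebesgue.
  refine ⟨F ∘ f, hg, hmg, ⋃ q : ℚ, {x | (q : ℝ) < f x ∧ F (f x) = F q}, ?_, ?_, ?_⟩
  · refine MeasurableSet.iUnion fun q => MeasurableSet.inter ?_ ?_
    · exact measurableSet_lt measurable_const hf.measurable
    · exact measurableSet_eq_fun hg measurable_const
  · refine measure_iUnion_null fun q => measure_mono_null (t := (F ∘ f) ⁻¹' {F q})
      (fun x hx => hx.2) ?_
    rw [← Measure.map_apply hg (measurableSet_singleton _), hmg]
    exact nonpos_iff_eq_zero.1 ((Measure.restrict_apply_le _ _).trans (by simp))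
  · have key : ∀ x y, f x < f y → F (f x) = F (f y) →
        y ∈ ⋃ q : ℚ, {x | (q : ℝ) < f x ∧ F (f x) = F q} := by
      intro x y hlt he
      obtain ⟨q, h1, h2⟩ := exists_rat_btwn hlt
      exact mem_iUnion.2 ⟨q, h2, le_antisymm (he ▸ hmono h1.le) (hmono h2.le)⟩
    intro x hx y hy hxy
    rcases lt_trichotomy (f x) (f y) with h | h | h
    · exact absurd (key x y h hxy) hy
    · exact hf.injective h
    · exact absurd (key y x h hxy.symm) hx

open Set in
/-- A set of finite measure contains as many disjoint sets of measure `c` as its measure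
permits. -/
theorem exists_disjoint_subsets_measure_eq {X : Type*} [MeasurableSpace X]
    [StandardBorelSpace X] (μ : Measure X) [NullSingletonClass μ] {B : Set X}
    (hB : MeasurableSet B) (hBfin : μ B ≠ ⊤) {c : ℝ} (hc : 0 < c) :
    ∃ E : Fin ⌊μ.real B / c⌋₊ → Set X, (∀ k, MeasurableSet (E k)) ∧ (∀ k, E k ⊆ B) ∧
      Pairwise (Function.onFun Disjoint E) ∧ ∀ k, μ (E k) = ENNReal.ofReal c := by
  have : IsFiniteMeasure (μ.restrict B) := ⟨by simpa using hBfin.lt_top⟩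
  obtain ⟨g, hg, hmap, -⟩ := exists_map_eq_volume (μ.restrict B)
  have hm : (μ.restrict B).real univ = μ.real B := by simp
  rw [hm] at hmap
  refine ⟨fun k => g ⁻¹' Ioc (k * c) ((k + 1) * c) ∩ B, fun k => (hg measurableSet_Ioc).inter hB,
    fun k => inter_subset_right, fun j k hjk => ?_, fun k => ?_⟩
  · wlog h : j < k generalizing j k
    · exact (this k j hjk.symm (lt_of_le_of_ne (not_lt.1 h) hjk.symm)).symm
    refine disjoint_left.2 fun x hx hx' => ?_
    have h1 := hx.1.2
    have h2 := hx'.1.1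
    have h3 : ((j : ℝ) + 1) ≤ k := by exact_mod_cast h
    have := mul_le_mul_of_nonneg_right h3 hc.le
    linarith
  · have hk : ((k : ℝ) + 1) * c ≤ μ.real B := by
      have h1 : ((k : ℕ) + 1 : ℕ) ≤ ⌊μ.real B / c⌋₊ := k.2
      have h2 := (Nat.le_floor_iff (by positivity)).1 h1
      rw [le_div_iff₀ hc] at h2
      exact_mod_cast h2
    rw [← Measure.restrict_apply (hg measurableSet_Ioc), ← Measure.map_apply hg measurableSet_Ioc,
      hmap, Measure.restrict_apply measurableSet_Ioc, inter_eq_left.2, Real.volume_Ioc]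
    · congr 1; ring
    · exact Ioc_subset_Ioc (by positivity) hk

open Set in
/-- Finitely many sets of the same finite measure in a non-atomic standard Borel space have a common
parametrization, up to null sets. -/
theorem exists_common_parametrization {X : Type*} [MeasurableSpace X] [StandardBorelSpace X]
    (μ : Measure X) [NullSingletonClass μ] {ι : Type*} [Finite ι] {E : ι → Set X} {c : ℝ}
    (hE : ∀ i, MeasurableSet (E i)) (hμE : ∀ i, μ (E i) = ENNReal.ofReal c) (hc : 0 ≤ c) :
    ∃ (D : Set ℝ) (ν : Measure D) (φ : ι → D → X), (∀ i, MeasurableEmbedding (φ i)) ∧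
      (∀ i, range (φ i) ⊆ E i) ∧ (∀ i, μ (E i \ range (φ i)) = 0) ∧
      ∀ i A, MeasurableSet A → μ (φ i '' A) = ν A := by
  have hfin : ∀ i, IsFiniteMeasure (μ.restrict (E i)) := fun i => ⟨by simp [hμE]⟩
  choose g hg hmap N hN hμN hinj using fun i => exists_map_eq_volume (μ.restrict (E i))
  have hm : ∀ i, (μ.restrict (E i)).real univ = c := fun i => by
    simp [measureReal_def, hμE, hc]
  simp only [hm] at hmap
  have hW : ∀ i, MeasurableSet (E i \ N i) := fun i => (hE i).diff (hN i)
  have hWinj : ∀ i, InjOn (g i) (E i \ N i) := fun i => (hinj i).mono fun x hx => hx.2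
  have hgW : ∀ i, MeasurableSet (g i '' (E i \ N i)) := fun i =>
    (hW i).image_of_measurable_injOn (hg i) (hWinj i)
  -- `D` keeps the parameters reached by every `g i`. Injective Borel images are Borel, and only a
  -- null part of `Ioc 0 c` is lost.
  set D : Set ℝ := Ioc 0 c ∩ ⋂ i, g i '' (E i \ N i) with hD
  have hDm : MeasurableSet D := measurableSet_Ioc.inter (MeasurableSet.iInter hgW)
  have hvol : ∀ A, MeasurableSet A → ∀ i, μ (g i ⁻¹' A ∩ E i) = volume (A ∩ Ioc 0 c) := by
    intro A hA i
    rw [← Measure.restrict_apply hA, ← hmap i, Measure.map_apply (hg i) hA,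
      Measure.restrict_apply (hg i hA)]
  have hDc : volume (Dᶜ ∩ Ioc 0 c) = 0 := by
    have : Dᶜ ∩ Ioc 0 c ⊆ ⋃ i, (g i '' (E i \ N i))ᶜ ∩ Ioc 0 c := by
      intro y hy
      by_contra hcon
      simp only [mem_iUnion, not_exists, mem_inter_iff, hy.2, and_true, mem_compl_iff,
        not_not] at hcon
      exact hy.1 ⟨hy.2, mem_iInter.2 hcon⟩
    refine measure_mono_null this (measure_iUnion_null fun i => ?_)
    rw [← hvol _ (hgW i).compl i]
    have h0 := hμN i
    rw [Measure.restrict_apply (hN i)] at h0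
    refine measure_mono_null (t := N i ∩ E i) (fun x hx => ⟨?_, hx.2⟩) h0
    by_contra hxN
    exact hx.1 ⟨x, ⟨hx.2, hxN⟩, rfl⟩
  set E' : ι → Set X := fun i => (E i \ N i) ∩ g i ⁻¹' D with hE'
  have hE'm : ∀ i, MeasurableSet (E' i) := fun i => (hW i).inter (hg i hDm)
  have hnull : ∀ i, μ (E i \ E' i) = 0 := by
    intro i
    have h0 := hμN i
    rw [Measure.restrict_apply (hN i)] at h0
    have h1 := hDc
    rw [← hvol _ hDm.compl i] at h1
    refine measure_mono_null (fun x hx => ?_) (measure_union_null h0 h1)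
    by_cases hxN : x ∈ N i
    · exact Or.inl ⟨hxN, hx.1⟩
    · exact Or.inr ⟨fun hxD => hx.2 ⟨⟨hx.1, hxN⟩, hxD⟩, hx.1⟩
  let G : ∀ i, E' i → D := fun i x => ⟨g i x, x.2.2⟩
  have hGm : ∀ i, Measurable (G i) := fun i => ((hg i).comp measurable_subtype_coe).subtype_mk
  have hGi : ∀ i, Function.Injective (G i) := fun i x y hxy =>
    Subtype.ext (hWinj i x.2.1 y.2.1 (congrArg Subtype.val hxy))
  have hGs : ∀ i, Function.Surjective (G i) := fun i d => by
    obtain ⟨x, hx, hxd⟩ := mem_iInter.1 d.2.2 i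
    exact ⟨⟨x, hx, by simp only [mem_preimage, hxd, d.2]⟩, Subtype.ext hxd⟩
  let e : ∀ i, E' i ≃ D := fun i => Equiv.ofBijective (G i) ⟨hGi i, hGs i⟩
  have hsB : ∀ i, StandardBorelSpace (E' i) := fun i => (hE'm i).standardBorel
  let e' : ∀ i, E' i ≃ᵐ D := fun i =>
    { toEquiv := e i
      measurable_toFun := hGm i
      measurable_invFun := fun S hS => by
        rw [← (e i).image_eq_preimage_symm]
        exact ((hGm i).measurableEmbedding (hGi i)).measurableSet_image.2 hS }
  have hrange : ∀ i, range (fun d => ((e' i).symm d : X)) = E' i := fun i => by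
    change range (Subtype.val ∘ (e' i).symm) = _
    rw [range_comp, (e' i).symm.surjective.range_eq, image_univ, Subtype.range_coe]
  refine ⟨D, volume.comap Subtype.val, fun i d => ((e' i).symm d : X), fun i =>
    (MeasurableEmbedding.subtype_coe (hE'm i)).comp (e' i).symm.measurableEmbedding,
    fun i => ?_, fun i => ?_, fun i A hA => ?_⟩
  · rw [hrange]
    exact fun x hx => hx.1.1
  · rw [hrange]
    exact hnull i
  · have hAm : MeasurableSet (Subtype.val '' A) := hDm.subtype_image hA
    rw [comap_subtype_coe_apply hDm]
    have h1 : Subtype.val '' A ∩ Ioc 0 c = Subtype.val '' A := by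
      refine inter_eq_left.2 ?_
      rintro _ ⟨d, -, rfl⟩
      exact d.2.1
    rw [← h1, ← hvol _ hAm i]
    have h2 : (fun d => ((e' i).symm d : X)) '' A = (g i ⁻¹' (Subtype.val '' A) ∩ E i) ∩ E' i := by
      ext x
      constructor
      · rintro ⟨d, hd, rfl⟩
        have hmem := ((e' i).symm d).2
        refine ⟨⟨⟨d, hd, ?_⟩, hmem.1.1⟩, hmem⟩
        exact (congrArg Subtype.val ((e' i).apply_symm_apply d)).symm
      · rintro ⟨⟨⟨d, hd, hdx⟩, -⟩, hx⟩
        refine ⟨d, hd, ?_⟩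
        have : (e' i) ⟨x, hx⟩ = d := Subtype.ext hdx.symm
        simp only [← this, MeasurableEquiv.symm_apply_apply]
    rw [h2]
    exact measure_inter_conull' (measure_mono_null (t := E i \ E' i)
      (fun x hx => ⟨hx.1.2, hx.2⟩) (hnull i))

/-! ### Symmetric groups acting by block permutations -/

namespace MeasureAut

open Set in
/-- The symmetric group of finitely many disjoint sets of the same finite measure acts on the space
by measure-preserving bijections, permuting the sets up to null sets. -/
theorem exists_perm_hom {X : Type*} [MeasurableSpace X] [StandardBorelSpace X]
    (μ : Measure X) [NullSingletonClass μ] {ι : Type*} [Fintype ι] {E : ι → Set X} {c : ℝ}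
    (hE : ∀ i, MeasurableSet (E i)) (hd : Pairwise (Function.onFun Disjoint E))
    (hμE : ∀ i, μ (E i) = ENNReal.ofReal c) (hc : 0 ≤ c) :
    ∃ (E' : ι → Set X) (ρ : Equiv.Perm ι →* pointwiseGroup μ),
      (∀ i, MeasurableSet (E' i)) ∧ (∀ i, E' i ⊆ E i) ∧ (∀ i, μ (E' i) = ENNReal.ofReal c) ∧
      (∀ σ i, ∀ x ∈ E' i, (ρ σ : Equiv.Perm X) x ∈ E' (σ i)) ∧
      ∀ σ x, (∀ i, x ∈ E' i → σ i = i) → (ρ σ : Equiv.Perm X) x = x := by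
  classical
  obtain ⟨D, ν, φ, hφ, hφE, hnull, hν⟩ := exists_common_parametrization μ hE hμE hc
  have hdis : ∀ {i j d d'}, φ i d = φ j d' → i = j := by
    intro i j d d' h
    by_contra hij
    exact disjoint_left.1 (hd hij) (hφE i ⟨d, rfl⟩) (h ▸ hφE j ⟨d', rfl⟩)
  let Φ : ι × D → X := fun p => φ p.1 p.2
  have hΦ : Function.Injective Φ := by
    rintro ⟨i, d⟩ ⟨j, d'⟩ h
    obtain rfl := hdis h
    exact congrArg _ ((hφ i).injective h)
  let f := Equiv.ofInjective Φ hΦ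
  -- All blocks share the parameter space `D`, so permuting the first coordinate gives a
  -- homomorphism pointwise, not only almost everywhere.
  let P : Equiv.Perm ι → Equiv.Perm (ι × D) := fun σ => σ.prodCongr (Equiv.refl D)
  let R : Equiv.Perm ι → Equiv.Perm X := fun σ => (P σ).extendDomain f
  have hR : ∀ σ i d, R σ (φ i d) = φ (σ i) d := fun σ i d =>
    (P σ).extendDomain_apply_image f (i, d)
  have hR' : ∀ σ x, (∀ i d, φ i d ≠ x) → R σ x = x := fun σ x hx =>
    (P σ).extendDomain_apply_not_subtype f (by rintro ⟨⟨i, d⟩, h⟩; exact hx i d h)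
  have hpre : ∀ σ (S : Set X), R σ ⁻¹' S =
      (⋃ i, φ i '' (φ (σ i) ⁻¹' S)) ∪ (S \ ⋃ i, range (φ i)) := by
    intro σ S
    ext x
    by_cases hx : ∃ i d, φ i d = x
    · obtain ⟨i, d, rfl⟩ := hx
      simp only [mem_preimage, hR, mem_union, mem_iUnion, mem_image, mem_sdiff, mem_range]
      constructor
      · exact fun h => Or.inl ⟨i, d, h, rfl⟩
      · rintro (⟨j, d', h, h'⟩ | ⟨-, h⟩)
        · obtain rfl := hdis h'
          rwa [← (hφ j).injective h']
        · exact absurd ⟨i, d, rfl⟩ h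
    · push Not at hx
      rw [mem_preimage, hR' σ x hx]
      constructor
      · exact fun h => Or.inr ⟨h, by simpa using hx⟩
      · rintro (h | h)
        · obtain ⟨i, d, -, h⟩ := mem_iUnion.1 h
          exact absurd h (hx i d)
        · exact h.1
  have hUm : MeasurableSet (⋃ i, range (φ i)) :=
    MeasurableSet.iUnion fun i => (hφ i).measurableSet_range
  have hRm : ∀ σ, Measurable (R σ) := fun σ S hS => by
    rw [hpre]
    exact (MeasurableSet.iUnion fun i => (hφ i).measurableSet_image.2
      ((hφ (σ i)).measurable hS)).union (hS.diff hUm)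
  -- The right-hand side does not involve `σ`; comparison with `R 1 = 1` gives invariance of `μ`.
  have hRμ : ∀ σ S, MeasurableSet S →
      μ (R σ ⁻¹' S) = ∑ i, ν (φ i ⁻¹' S) + μ (S \ ⋃ i, range (φ i)) := by
    intro σ S hS
    rw [hpre, measure_union _ (hS.diff hUm), measure_iUnion, tsum_fintype]
    · congr 1
      rw [← Equiv.sum_comp σ fun i => ν (φ i ⁻¹' S)]
      exact Finset.sum_congr rfl fun i _ => hν i _ ((hφ (σ i)).measurable hS)
    · intro i j hij
      refine (hd hij).mono ?_ ?_ <;> exact (image_subset_range _ _).trans (hφE _)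
    · exact fun i => (hφ i).measurableSet_image.2 ((hφ (σ i)).measurable hS)
    · refine disjoint_left.2 fun x hx hx' => hx'.2 ?_
      obtain ⟨i, hi⟩ := mem_iUnion.1 hx
      exact mem_iUnion.2 ⟨i, image_subset_range _ _ hi⟩
  have hone : R 1 = 1 := by
    ext x
    by_cases hx : ∃ i d, φ i d = x
    · obtain ⟨i, d, rfl⟩ := hx
      rw [hR]; rfl
    · push Not at hx
      exact hR' 1 x hx
  have hmul : ∀ σ τ, R (σ * τ) = R σ * R τ := by
    intro σ τ
    ext x
    rw [Equiv.Perm.mul_apply]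
    by_cases hx : ∃ i d, φ i d = x
    · obtain ⟨i, d, rfl⟩ := hx
      rw [hR, hR, hR]; rfl
    · push Not at hx
      rw [hR' τ x hx, hR' σ x hx, hR' _ x hx]
  have hmp : ∀ σ, MeasurePreserving (R σ) μ μ := fun σ => ⟨hRm σ, by
    ext S hS
    rw [Measure.map_apply (hRm σ) hS, hRμ σ S hS, ← hRμ 1 S hS, hone]
    rfl⟩
  have hinv : ∀ σ, (R σ).symm = R σ⁻¹ := fun σ => by
    change (R σ)⁻¹ = _
    rw [inv_eq_iff_mul_eq_one, ← hmul, mul_inv_cancel, hone]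
  refine ⟨fun i => range (φ i),
    { toFun := fun σ => ⟨R σ, hmp σ, by rw [hinv]; exact hmp _⟩
      map_one' := Subtype.ext hone
      map_mul' := fun σ τ => Subtype.ext (hmul σ τ) },
    fun i => (hφ i).measurableSet_range, hφE, fun i => ?_, ?_, ?_⟩
  · change μ (range (φ i)) = _
    rw [← hμE i, ← inter_eq_right.2 (hφE i)]
    exact measure_inter_conull' (hnull i)
  · rintro σ i _ ⟨d, rfl⟩
    exact ⟨d, (hR σ i d).symm⟩
  · intro σ x hx
    by_cases h : ∃ i d, φ i d = x
    · obtain ⟨i, d, rfl⟩ := h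
      change R σ _ = _
      rw [hR, hx i ⟨d, rfl⟩]
    · push Not at h
      exact hR' σ x h

end MeasureAut

/-! ### Neighbourhoods of the identity in the strong topology -/

namespace MeasureAut

/-- The class in `Aut(X, μ)` of a measure-preserving bijection. -/
def mkHom {X : Type*} [MeasurableSpace X] (μ : Measure X) : pointwiseGroup μ →* MeasureAut μ :=
  QuotientGroup.mk' (nullSubgroup μ)

theorem mkHom_surjective {X : Type*} [MeasurableSpace X] (μ : Measure X) :
    Function.Surjective (mkHom μ) :=
  QuotientGroup.mk'_surjective _

open Filter Topology symmDiff in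
/-- Convergence in measure on all sets of finite measure implies convergence of the Koopman
operators to the identity. -/
theorem tendsto_koopmanAux {X : Type*} [MeasurableSpace X] (μ : Measure X)
    {l : Filter (pointwiseGroup μ)} (hl : ∀ A, MeasurableSet A → μ A ≠ ⊤ →
      Tendsto (fun T : pointwiseGroup μ => μ (((T : Equiv.Perm X) ⁻¹' A) ∆ A)) l (𝓝 0))
    (f : Lp ℂ 2 μ) : Tendsto (fun T => koopmanAux μ T f) l (𝓝 f) := by
  induction f using Lp.induction (p := 2) ENNReal.ofNat_ne_top with
  | @indicatorConst c s hs hμs =>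
    -- The operator involves `T.symm`, the hypothesis `T`; applying `T` shows that both symmetric
    -- differences have the same measure.
    have h : Tendsto (fun T : pointwiseGroup μ => μ (((T : Equiv.Perm X).symm ⁻¹' s) ∆ s)) l
        (𝓝 0) := by
      refine (hl s hs hμs.ne).congr fun T => ?_
      have hm : MeasurableSet (((T : Equiv.Perm X).symm ⁻¹' s) ∆ s) :=
        (T.2.2.measurable hs).symmDiff hs
      rw [← T.2.1.measure_preimage hm.nullMeasurableSet, Set.preimage_symmDiff,
        ← Set.preimage_comp, Equiv.symm_comp_self, Set.preimage_id, symmDiff_comm]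
    exact tendsto_indicatorConstLp_set (p := 2) (c := c) (hs := hs) (hμs := hμs.ne)
      (ht := fun T : pointwiseGroup μ => T.2.2.measurable hs)
      (hμt := fun T : pointwiseGroup μ => by
        rw [T.2.2.measure_preimage hs.nullMeasurableSet]; exact hμs.ne) (by simp) h
  | add hf hg _ h1 h2 => simpa only [map_add] using h1.add h2
  | isClosed =>
    rw [← isSeqClosed_iff_isClosed]
    intro u f hu hlim
    change Tendsto (fun T => koopmanAux μ T f) l (𝓝 f)
    rw [Metric.tendsto_nhds]
    intro ε hε
    obtain ⟨n, hn⟩ := ((Metric.tendsto_nhds.1 hlim) (ε / 3) (by positivity)).exists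
    filter_upwards [(Metric.tendsto_nhds.1 (hu n)) (ε / 3) (by positivity)] with T hT
    have h1 := dist_triangle4 (koopmanAux μ T f) (koopmanAux μ T (u n)) (u n) f
    rw [LinearIsometryEquiv.dist_map, dist_comm f] at h1
    linarith

open Filter Topology symmDiff in
/-- A neighbourhood of the identity contains all automorphisms that almost preserve suitable
finitely many sets of finite measure. -/
theorem exists_finset_of_mem_nhds_one {X : Type*} [MeasurableSpace X] (μ : Measure X)
    {V : Set (MeasureAut μ)} (hV : V ∈ 𝓝 1) :
    ∃ (𝒜 : Finset (Set X)) (δ : ℝ), 0 < δ ∧ (∀ A ∈ 𝒜, MeasurableSet A ∧ μ A ≠ ⊤) ∧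
      ∀ T : pointwiseGroup μ, (∀ A ∈ 𝒜, μ (((T : Equiv.Perm X) ⁻¹' A) ∆ A) < ENNReal.ofReal δ) →
        mkHom μ T ∈ V := by
  classical
  let ι := {A : Set X // MeasurableSet A ∧ μ A ≠ ⊤}
  let d : ι → pointwiseGroup μ → ENNReal := fun A T => μ (((T : Equiv.Perm X) ⁻¹' A.1) ∆ A.1)
  -- The coarsest filter along which every `d A` tends to zero; membership in it involves only
  -- finitely many `A`.
  let l : Filter (pointwiseGroup μ) := ⨅ A : ι, comap (d A) (𝓝 0)
  have hl : Tendsto (mkHom μ) l (𝓝 1) := by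
    rw [nhds_induced, tendsto_comap_iff, tendsto_pi_nhds]
    intro f
    have h := tendsto_koopmanAux μ (l := l) (fun A hA hA' =>
      tendsto_iff_comap.2 (iInf_le (fun A : ι => comap (d A) (𝓝 0)) ⟨A, hA, hA'⟩)) f
    change Tendsto (fun T => koopmanAux μ T f) l (𝓝 (koopman μ 1 f))
    rw [map_one]
    exact h
  obtain ⟨t, ht⟩ := (mem_iInf_finite (f := fun A : ι => comap (d A) (𝓝 0)) _).1 (hl hV)
  obtain ⟨p, hp, hpV⟩ := mem_iInf_finset.1 ht
  have hδ : ∀ A : ι, ∃ δ : ℝ, 0 < δ ∧ (A ∈ t → ∀ T, d A T < ENNReal.ofReal δ → T ∈ p A) := by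
    intro A
    by_cases hA : A ∈ t
    · obtain ⟨W, hW, hWp⟩ := mem_comap.1 (hp A hA)
      obtain ⟨ε, hε, hεW⟩ := ENNReal.nhds_zero_basis.mem_iff.1 hW
      obtain ⟨δ, hδ0, hδ⟩ := ENNReal.lt_iff_exists_nnreal_btwn.1 hε
      refine ⟨δ, by exact_mod_cast hδ0, fun _ T hT => hWp (hεW ?_)⟩
      rw [ENNReal.ofReal_coe_nnreal] at hT
      exact hT.trans hδ
    · exact ⟨1, one_pos, fun h => absurd h hA⟩
  choose δ hδ0 hδ using hδ
  obtain ⟨η, hη0, hη⟩ : ∃ η : ℝ, 0 < η ∧ ∀ A ∈ t, η ≤ δ A := by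
    rcases t.eq_empty_or_nonempty with rfl | hne
    · exact ⟨1, one_pos, by simp⟩
    · exact ⟨t.inf' hne δ, (Finset.lt_inf'_iff hne).2 fun A _ => hδ0 A,
        fun A hA => Finset.inf'_le _ hA⟩
  refine ⟨t.image Subtype.val, η, hη0, fun A hA => ?_, fun T hT => ?_⟩
  · obtain ⟨B, -, rfl⟩ := Finset.mem_image.1 hA
    exact B.2
  · change T ∈ mkHom μ ⁻¹' V
    rw [hpV]
    refine Set.mem_iInter₂.2 fun A hA => hδ A hA T ?_
    exact (hT A (Finset.mem_image_of_mem _ hA)).trans_le (ENNReal.ofReal_le_ofReal (hη A hA))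

end MeasureAut

/-! ### Weak approximation by permutations -/

namespace MeasureAut

set_option maxHeartbeats 1000000 in
open Set symmDiff in
/-- Weak approximation: finitely many measure-preserving bijections are approximated simultaneously
by permutations of finitely many sets of equal, arbitrarily small measure. -/
theorem exists_perm_approx {X : Type*} [MeasurableSpace X] [StandardBorelSpace X]
    (μ : Measure X) [NullSingletonClass μ] (F : Finset (pointwiseGroup μ)) (𝒜 : Finset (Set X))
    (h𝒜 : ∀ A ∈ 𝒜, MeasurableSet A ∧ μ A ≠ ⊤) {δ : ℝ} (hδ : 0 < δ) :
    ∃ C : ℝ, 0 ≤ C ∧ ∀ η : ℝ, 0 < η → ∃ (c : ℝ) (n : ℕ)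
      (ρ : Equiv.Perm (Fin n) →* pointwiseGroup μ), 0 < c ∧ c ≤ η ∧ c * n ≤ C ∧
      (∀ σ A, μ (((ρ σ : Equiv.Perm X) ⁻¹' A) ∆ A) ≤
        ENNReal.ofReal (c * (Finset.univ.filter fun i => σ i ≠ i).card)) ∧
      ∀ g ∈ F, ∃ σ, ∀ A ∈ 𝒜,
        μ ((((g * ρ σ : pointwiseGroup μ) : Equiv.Perm X) ⁻¹' A) ∆ A) < ENNReal.ofReal δ := by
  classical
  let J := {A : Set X // A ∈ 𝒜}
  let H := {g : pointwiseGroup μ // g ∈ insert 1 F}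
  -- A pattern records, for every `g`, which sets contain `g x`. Including `g = 1` records the
  -- position of `x` itself; requiring a nonempty entry keeps the cells of finite measure.
  let L := {l : H → Set J // ∃ g A, A ∈ l g}
  let _ : Fintype J := inferInstanceAs (Fintype {A : Set X // A ∈ 𝒜})
  let _ : Fintype H := inferInstanceAs (Fintype {g : pointwiseGroup μ // g ∈ insert 1 F})
  let _ : Fintype L := inferInstanceAs (Fintype {l : H → Set J // ∃ g A, A ∈ l g})
  let one : H := ⟨1, Finset.mem_insert_self _ _⟩
  have hJm : ∀ A : J, MeasurableSet A.1 := fun A => (h𝒜 A.1 A.2).1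
  have hJf : ∀ A : J, μ A.1 ≠ ⊤ := fun A => (h𝒜 A.1 A.2).2
  have hHm : ∀ g : H, Measurable (g.1 : Equiv.Perm X) := fun g => g.1.2.1.measurable
  let q : X → H → Set J := fun x g => {A | (g.1 : Equiv.Perm X) x ∈ A.1}
  let B : L → Set X := fun l => {x | q x = l.1}
  have hBm : ∀ l, MeasurableSet (B l) := by
    intro l
    have : B l = ⋂ g : H, ⋂ A : J, {x | (g.1 : Equiv.Perm X) x ∈ A.1 ↔ A ∈ l.1 g} := by
      ext x
      simp only [B, q, mem_ofPred_eq, mem_iInter, funext_iff, Set.ext_iff]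
    rw [this]
    refine MeasurableSet.iInter fun g => MeasurableSet.iInter fun A => ?_
    by_cases h : A ∈ l.1 g
    · have : {x | (g.1 : Equiv.Perm X) x ∈ A.1 ↔ A ∈ l.1 g} = (g.1 : Equiv.Perm X) ⁻¹' A.1 := by
        ext x; simp [h]
      rw [this]
      exact hHm g (hJm A)
    · have : {x | (g.1 : Equiv.Perm X) x ∈ A.1 ↔ A ∈ l.1 g} =
          ((g.1 : Equiv.Perm X) ⁻¹' A.1)ᶜ := by
        ext x; simp [h]
      rw [this]
      exact (hHm g (hJm A)).compl
  have hBfin : ∀ l, μ (B l) ≠ ⊤ := by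
    rintro ⟨l, g, A, hA⟩
    refine ne_top_of_le_ne_top (hJf A) ?_
    rw [← g.1.2.1.measure_preimage (hJm A).nullMeasurableSet]
    refine measure_mono fun x hx => ?_
    have hx' : q x = l := hx
    rw [← hx'] at hA
    exact hA
  let P : Set J → Set X := fun S => {x | {A : J | x ∈ A.1} = S}
  have hPm : ∀ S, MeasurableSet (P S) := by
    intro S
    have : P S = ⋂ A : J, {x | x ∈ A.1 ↔ A ∈ S} := by
      ext x
      simp only [P, mem_ofPred_eq, mem_iInter, Set.ext_iff]
    rw [this]
    refine MeasurableSet.iInter fun A => ?_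
    by_cases h : A ∈ S
    · simpa [h] using hJm A
    · have : {x | x ∈ A.1 ↔ A ∈ S} = A.1ᶜ := by ext x; simp [h]
      rw [this]
      exact (hJm A).compl
  -- Since `g` preserves `μ`, the atom `P S` and its preimage have equal measure. Hence the
  -- colourings by `1` and by `g` have the same lower bound on their classes.
  have hPle : ∀ (g : H) (S : Set J), S.Nonempty →
      μ.real (P S) ≤ ∑ l ∈ Finset.univ.filter (fun l : L => l.1 g = S), μ.real (B l) := by
    rintro g S ⟨A, hA⟩
    have h1 : μ.real (P S) = μ.real ((g.1 : Equiv.Perm X) ⁻¹' P S) := by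
      rw [measureReal_def, measureReal_def, g.1.2.1.measure_preimage (hPm S).nullMeasurableSet]
    rw [h1]
    refine le_trans (measureReal_mono (fun x hx => ?_) ?_) (measureReal_biUnion_finset_le _ _)
    · have hx' : q x g = S := hx
      exact mem_iUnion₂.2 ⟨⟨q x, g, A, hx' ▸ hA⟩, by simpa using hx', rfl⟩
    · exact (measure_biUnion_lt_top (Finset.finite_toSet _)
        fun l _ => (hBfin l).lt_top).ne
  have hAle : ∀ A : J, μ.real A.1 ≤
      ∑ S ∈ Finset.univ.filter (fun S : Set J => A ∈ S), μ.real (P S) := by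
    intro A
    refine le_trans (measureReal_mono (fun x hx => ?_) ?_) (measureReal_biUnion_finset_le _ _)
    · exact mem_iUnion₂.2 ⟨{A | x ∈ A.1}, by simpa using hx, rfl⟩
    · refine (measure_biUnion_lt_top (Finset.finite_toSet _) fun S hS => ?_).ne
      refine lt_of_le_of_lt (measure_mono fun x hx => ?_) (hJf A).lt_top
      have hx' : {A : J | x ∈ A.1} = S := hx
      have hAS : A ∈ S := by simpa using hS
      rw [← hx'] at hAS
      exact hAS
  set κ : ℝ := Fintype.card L * Fintype.card (Set J) with hκ
  have hκ0 : 0 ≤ κ := by positivity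
  refine ⟨∑ l, μ.real (B l), Finset.sum_nonneg fun l _ => measureReal_nonneg, fun η hη => ?_⟩
  -- Cutting a cell into blocks of measure `c` wastes less than `c`; over all cells and atoms the
  -- loss is at most `κ * c`, and it will count twice.
  obtain ⟨c, hc0, hcη, hcκ⟩ : ∃ c : ℝ, 0 < c ∧ c ≤ η ∧ 2 * (κ * c) < δ := by
    refine ⟨min η (δ / (2 * κ + 1)), lt_min hη (by positivity), min_le_left _ _, ?_⟩
    have h1 : min η (δ / (2 * κ + 1)) ≤ δ / (2 * κ + 1) := min_le_right _ _
    calc 2 * (κ * min η (δ / (2 * κ + 1))) ≤ 2 * (κ * (δ / (2 * κ + 1))) := by gcongr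
      _ = 2 * κ / (2 * κ + 1) * δ := by ring
      _ < 1 * δ := by
        gcongr
        rw [div_lt_one (by positivity)]
        linarith
      _ = δ := one_mul δ
  choose E hEm hEB hEd hEμ using fun l =>
    exists_disjoint_subsets_measure_eq μ (hBm l) (hBfin l) hc0
  let ι := Σ l : L, Fin ⌊μ.real (B l) / c⌋₊
  let _ : Fintype ι := inferInstanceAs (Fintype (Σ l : L, Fin ⌊μ.real (B l) / c⌋₊))
  let e := (Fintype.equivFin ι).symm
  have hdisj : Pairwise (Function.onFun Disjoint fun i => E (e i).1 (e i).2) := by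
    have key : ∀ s t : ι, s ≠ t → Disjoint (E s.1 s.2) (E t.1 t.2) := by
      rintro ⟨l, k⟩ ⟨l', k'⟩ hne
      by_cases hl : l = l'
      · subst hl
        exact hEd l fun h => hne (congrArg (Sigma.mk l) h)
      · refine disjoint_left.2 fun x hx hx' => hl (Subtype.ext ?_)
        exact (hEB l k hx : q x = l.1).symm.trans (hEB l' k' hx')
    exact fun i j hij => key _ _ fun h => hij (e.injective h)
  obtain ⟨E', ρ, hE'm, hE'E, hE'μ, hρ, hρfix⟩ := exists_perm_hom μ
    (fun i => hEm (e i).1 (e i).2) hdisj (fun i => hEμ (e i).1 (e i).2) hc0.le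
  have hE'd : Pairwise (Function.onFun Disjoint E') := fun i j hij =>
    (hdisj hij).mono (hE'E i) (hE'E j)
  have hE'q : ∀ i, ∀ x ∈ E' i, q x = (e i).1.1 := fun i x hx => hEB _ _ (hE'E i hx)
  have hU : ∀ s : Finset (Fin (Fintype.card ι)),
      μ (⋃ i ∈ s, E' i) = ENNReal.ofReal (c * s.card) := by
    intro s
    rw [measure_biUnion_finset (fun i _ j _ hij => hE'd hij) fun i _ => hE'm i]
    simp only [hE'μ, Finset.sum_const, nsmul_eq_mul]
    rw [mul_comm c, ENNReal.ofReal_mul (by positivity), ENNReal.ofReal_natCast]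
  have hcount : ∀ (g : H) (S : Set J), S.Nonempty → μ.real (P S) - Fintype.card L * c ≤
      c * (Finset.univ.filter fun i => (e i).1.1 g = S).card := by
    intro g S hS
    have h1 : (Finset.univ.filter fun i => (e i).1.1 g = S).card =
        ∑ l ∈ Finset.univ.filter (fun l : L => l.1 g = S), ⌊μ.real (B l) / c⌋₊ := by
      calc _ = (Finset.univ.filter fun s : ι => s.1.1 g = S).card :=
            Finset.card_bij (fun i _ => e i) (by simp) (by simp)
              fun s hs => ⟨e.symm s, by simpa using hs, by simp⟩
        _ = ((Finset.univ.filter fun l : L => l.1 g = S).sigma fun l =>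
              (Finset.univ : Finset (Fin ⌊μ.real (B l) / c⌋₊))).card := by
            congr 1
            ext s
            rw [Finset.mem_filter, Finset.mem_sigma, Finset.mem_filter]
            simp only [Finset.mem_univ, true_and, and_true]
        _ = _ := by simp [Finset.card_sigma]
    rw [h1, Nat.cast_sum, Finset.mul_sum]
    have h2 : ∀ l : L, μ.real (B l) - c ≤ c * (⌊μ.real (B l) / c⌋₊ : ℝ) := by
      intro l
      have h3 := Nat.lt_floor_add_one (μ.real (B l) / c)
      rw [div_lt_iff₀ hc0] at h3
      linarith
    refine le_trans ?_ (Finset.sum_le_sum fun l _ => h2 l)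
    rw [Finset.sum_sub_distrib, Finset.sum_const, nsmul_eq_mul]
    have h4 : ((Finset.univ.filter fun l : L => l.1 g = S).card : ℝ) ≤ Fintype.card L := by
      exact_mod_cast Finset.card_le_univ _
    have h5 := mul_le_mul_of_nonneg_right h4 hc0.le
    linarith [hPle g S hS]
  refine ⟨c, Fintype.card ι, ρ, hc0, hcη, ?_, fun σ A => ?_, fun g hg => ?_⟩
  · rw [Fintype.card_sigma, Nat.cast_sum, Finset.mul_sum]
    refine Finset.sum_le_sum fun l _ => ?_
    rw [Fintype.card_fin]
    have h3 := Nat.floor_le (a := μ.real (B l) / c) (by positivity)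
    rw [le_div_iff₀ hc0] at h3
    linarith
  -- Membership in `A` can change only on blocks that `σ` moves.
  · rw [← hU]
    refine measure_mono fun x hx => ?_
    by_contra hcon
    have hfix : (ρ σ : Equiv.Perm X) x = x := hρfix σ x fun i hi => by
      by_contra hne
      exact hcon (mem_iUnion₂.2 ⟨i, by simpa using hne, hi⟩)
    rw [mem_symmDiff, mem_preimage, hfix] at hx
    tauto
  · let g' : H := ⟨g, Finset.mem_insert_of_mem hg⟩
    -- A matched block lying in an atom `S` is sent by `ρ σ` to a block that `g` maps into `S`.
    obtain ⟨σ, hσ⟩ := exists_perm_matching (fun i => (e i).1.1 one) fun i => (e i).1.1 g'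
    refine ⟨σ, fun A hA => ?_⟩
    let A' : J := ⟨A, hA⟩
    have hAm := hJm A'
    have hAf := hJf A'
    set T : pointwiseGroup μ := g * ρ σ with hT
    let I := Finset.univ.filter fun i => A' ∈ (e i).1.1 one ∧ (e i).1.1 one = (e (σ i)).1.1 g'
    have hI : μ.real A - κ * c ≤ c * I.card := by
      have h1 : I.card = ∑ S ∈ Finset.univ.filter (fun S : Set J => A' ∈ S),
          (Finset.univ.filter fun i => (e i).1.1 one = S ∧ (e (σ i)).1.1 g' = S).card := by
        rw [Finset.card_eq_sum_card_fiberwise (f := fun i => (e i).1.1 one)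
          (t := Finset.univ.filter fun S : Set J => A' ∈ S)]
        · refine Finset.sum_congr rfl fun S hS => ?_
          congr 1
          ext i
          simp only [I, Finset.mem_filter, Finset.mem_univ, true_and] at hS ⊢
          constructor
          · rintro ⟨⟨-, h⟩, rfl⟩
            exact ⟨rfl, h.symm⟩
          · rintro ⟨rfl, h⟩
            exact ⟨⟨hS, h.symm⟩, rfl⟩
        · intro i hi
          simp only [I, Finset.coe_filter, Finset.mem_univ, true_and, mem_ofPred_eq] at hi ⊢
          exact hi.1
      rw [h1, Nat.cast_sum, Finset.mul_sum]
      calc μ.real A - κ * c ≤ ∑ S ∈ Finset.univ.filter (fun S : Set J => A' ∈ S),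
            (μ.real (P S) - Fintype.card L * c) := by
            rw [Finset.sum_sub_distrib, Finset.sum_const, nsmul_eq_mul]
            have h4 : ((Finset.univ.filter fun S : Set J => A' ∈ S).card : ℝ) ≤
                Fintype.card (Set J) := by exact_mod_cast Finset.card_le_univ _
            have h5 : 0 ≤ (Fintype.card L : ℝ) * c := by positivity
            have h6 := mul_le_mul_of_nonneg_right h4 h5
            have h7 : κ * c = Fintype.card (Set J) * (Fintype.card L * c) := by rw [hκ]; ring
            linarith [hAle A']
        _ ≤ _ := by
            refine Finset.sum_le_sum fun S hS => ?_
            have hSne : S.Nonempty := ⟨A', by simpa using hS⟩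
            refine le_trans ?_ (mul_le_mul_of_nonneg_left (Nat.cast_le.2 (hσ S)) hc0.le)
            rcases min_choice (Finset.univ.filter fun i => (e i).1.1 one = S).card
              (Finset.univ.filter fun i => (e i).1.1 g' = S).card with h | h <;> rw [h]
            · exact hcount one S hSne
            · exact hcount g' S hSne
    set U := ⋃ i ∈ I, E' i with hUdef
    have hUm : MeasurableSet U := Finset.measurableSet_biUnion _ fun i _ => hE'm i
    have hUA : U ⊆ A := by
      intro x hx
      obtain ⟨i, hi, hxi⟩ := mem_iUnion₂.1 hx
      have h1 : A' ∈ (e i).1.1 one := (Finset.mem_filter.1 hi).2.1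
      rw [← hE'q i x hxi] at h1
      exact h1
    have hUT : U ⊆ (T : Equiv.Perm X) ⁻¹' A := by
      intro x hx
      obtain ⟨i, hi, hxi⟩ := mem_iUnion₂.1 hx
      have h1 : A' ∈ (e i).1.1 one := (Finset.mem_filter.1 hi).2.1
      rw [(Finset.mem_filter.1 hi).2.2, ← hE'q (σ i) _ (hρ σ i x hxi)] at h1
      exact h1
    have hTA : μ ((T : Equiv.Perm X) ⁻¹' A) = μ A :=
      T.2.1.measure_preimage hAm.nullMeasurableSet
    have hUr : μ.real U = c * I.card := by
      rw [measureReal_def, hU,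
        ENNReal.toReal_ofReal (mul_nonneg hc0.le (Nat.cast_nonneg _))]
    -- `U`, the matched blocks inside `A`, lies in both sets, and each exceeds it by at most `κ *
    -- c`.
    have hsub : ((T : Equiv.Perm X) ⁻¹' A) ∆ A ⊆ ((T : Equiv.Perm X) ⁻¹' A \ U) ∪ (A \ U) := by
      rintro x (hx | hx)
      · exact Or.inl ⟨hx.1, fun h => hx.2 (hUA h)⟩
      · exact Or.inr ⟨hx.1, fun h => hx.2 (hUT h)⟩
    have hTf : μ ((T : Equiv.Perm X) ⁻¹' A) ≠ ⊤ := hTA ▸ hAf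
    have hfin : μ (((T : Equiv.Perm X) ⁻¹' A \ U) ∪ (A \ U)) ≠ ⊤ :=
      measure_union_ne_top (measure_ne_top_of_subset sdiff_subset hTf)
        (measure_ne_top_of_subset sdiff_subset hAf)
    rw [ENNReal.lt_ofReal_iff_toReal_lt (measure_ne_top_of_subset hsub hfin)]
    calc μ.real (((T : Equiv.Perm X) ⁻¹' A) ∆ A)
        ≤ μ.real (((T : Equiv.Perm X) ⁻¹' A \ U) ∪ (A \ U)) := measureReal_mono hsub hfin
      _ ≤ μ.real ((T : Equiv.Perm X) ⁻¹' A \ U) + μ.real (A \ U) := measureReal_union_le _ _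
      _ = 2 * (μ.real A - c * I.card) := by
          rw [measureReal_sdiff hUT hUm hTf, measureReal_sdiff hUA hUm hAf, hUr,
            measureReal_def, hTA, ← measureReal_def]
          ring
      _ < δ := by linarith

end MeasureAut

/-! ### Almost fixed points and concentration -/

open Filter Topology in
/-- The uniform continuity of the action of a topological group on the continuous functions on a
compact space. -/
theorem eventually_forall_abs_sub_lt {G K : Type*} [Group G] [TopologicalSpace G]
    [TopologicalSpace K] [CompactSpace K] [MulAction G K] [ContinuousSMul G K] (f : C(K, ℝ))
    {ε : ℝ} (hε : 0 < ε) : ∀ᶠ g : G in 𝓝 1, ∀ x : K, |f (g • x) - f x| < ε := by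
  -- Currying turns joint continuity into continuity for the uniform norm, as `K` is compact.
  let Ψ : C(G, C(K, ℝ)) := ContinuousMap.curry ⟨fun p : G × K => f (p.1 • p.2), by fun_prop⟩
  have h := Metric.tendsto_nhds.1 (Ψ.continuous.tendsto 1) ε hε
  filter_upwards [h] with g hg x
  have h1 := (ContinuousMap.dist_apply_le_dist x).trans_lt hg
  simpa [Ψ, Real.dist_eq] using h1

/-- A fixed point exists as soon as finitely many group elements almost fix some point, as seen by
finitely many continuous functions. -/
theorem exists_fixed_point_of_almost_fixed {Γ K : Type*} [TopologicalSpace K] [CompactSpace K]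
    [T2Space K] (a : Γ → K → K) (ha : ∀ g, Continuous (a g))
    (h : ∀ (S : Finset (Γ × C(K, ℝ))) (ε : ℝ), 0 < ε →
      ∃ x, ∀ p ∈ S, |p.2 (a p.1 x) - p.2 x| ≤ ε) : ∃ x, ∀ g, a g x = x := by
  classical
  let Z : (Γ × C(K, ℝ)) × {ε : ℝ // 0 < ε} → Set K :=
    fun q => {x | |q.1.2 (a q.1.1 x) - q.1.2 x| ≤ q.2}
  have hne : (⋂ q, Z q).Nonempty := by
    refine CompactSpace.iInter_nonempty (fun q => ?_) fun s => ?_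
    · have := ha q.1.1
      exact isClosed_le (by fun_prop) continuous_const
    · obtain ⟨ε, hε0, hε⟩ : ∃ ε : ℝ, 0 < ε ∧ ∀ q ∈ s, ε ≤ q.2 := by
        rcases s.eq_empty_or_nonempty with rfl | hs
        · exact ⟨1, one_pos, by simp⟩
        · exact ⟨s.inf' hs fun q => (q.2 : ℝ), (Finset.lt_inf'_iff hs).2 fun q _ => q.2.2,
            fun q hq => Finset.inf'_le (fun q => (q.2 : ℝ)) hq⟩
      obtain ⟨x, hx⟩ := h (s.image Prod.fst) ε hε0
      exact ⟨x, Set.mem_iInter₂.2 fun q hq =>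
        (hx q.1 (Finset.mem_image_of_mem _ hq)).trans (hε q hq)⟩
  obtain ⟨x, hx⟩ := hne
  refine ⟨x, fun g => ?_⟩
  by_contra hgx
  obtain ⟨f, hf⟩ : ∃ f : C(K, ℝ), f (a g x) ≠ f x := by
    obtain ⟨f, h0, h1, -⟩ := exists_continuous_zero_one_of_isClosed
      (isClosed_singleton (x := a g x)) (isClosed_singleton (x := x))
      (Set.disjoint_singleton.2 hgx)
    refine ⟨f, ?_⟩
    rw [h0 rfl, h1 rfl]
    exact zero_ne_one
  have hpos : 0 < |f (a g x) - f x| := abs_pos.2 (sub_ne_zero.2 hf)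
  have := Set.mem_iInter.1 hx ((g, f), ⟨_, half_pos hpos⟩)
  exact absurd (show |f (a g x) - f x| ≤ |f (a g x) - f x| / 2 from this) (by linarith)

/-- Finitely many functions on a symmetric group that are almost constant on small Hamming balls are
almost invariant under finitely many translations, at a common point. -/
theorem exists_perm_almost_invariant {n : ℕ} {ι : Type*} (S : Finset ι)
    (φ : ι → Equiv.Perm (Fin n) → ℝ) (τ : ι → Equiv.Perm (Fin n)) {B c δ ε : ℝ} (hc : 0 < c)
    (hδ : 0 < δ) (hε : 0 < ε) (hB : ∀ p ∈ S, ∀ σ, |φ p σ| ≤ B)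
    (hφ : ∀ p ∈ S, ∀ σ σ', c * (Finset.univ.filter fun i => σ i ≠ σ' i).card < δ →
      |φ p σ - φ p σ'| ≤ ε)
    (hn : 4 * S.card * (n * (2 * (2 * B / δ) * c) ^ 2) ≤ ε ^ 2) :
    ∃ σ, ∀ p ∈ S, |φ p (τ p * σ) - φ p σ| ≤ 3 * ε := by
  classical
  let d : Equiv.Perm (Fin n) → Equiv.Perm (Fin n) → ℝ := fun σ σ' =>
    c * (Finset.univ.filter fun i => σ i ≠ σ' i).card
  have dtri : ∀ x y z, d x z ≤ d x y + d y z := by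
    intro x y z
    simp only [d]
    rw [← mul_add]
    refine mul_le_mul_of_nonneg_left ?_ hc.le
    norm_cast
    refine (Finset.card_le_card fun i hi => ?_).trans (Finset.card_union_le _ _)
    simp only [Finset.mem_filter, Finset.mem_univ, true_and, Finset.mem_union] at hi ⊢
    by_contra! hcon
    exact hi (hcon.1.trans hcon.2)
  have hswap : ∀ a b σ, d (Equiv.swap a b * σ) σ ≤ 2 * c := by
    intro a b σ
    have : (Finset.univ.filter fun i => (Equiv.swap a b * σ) i ≠ σ i).card ≤ 2 := by
      refine (Finset.card_le_card (t := {σ⁻¹ a, σ⁻¹ b}) fun i hi => ?_).trans Finset.card_le_two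
      simp only [Finset.mem_filter, Finset.mem_univ, true_and, Finset.mem_insert,
        Finset.mem_singleton] at hi ⊢
      by_contra! hcon
      refine hi ?_
      rw [Equiv.Perm.mul_apply]
      refine Equiv.swap_apply_of_ne_of_ne ?_ ?_
      · rintro rfl; simp at hcon
      · rintro rfl; simp at hcon
    have h2 : ((Finset.univ.filter fun i => (Equiv.swap a b * σ) i ≠ σ i).card : ℝ) ≤ 2 := by
      exact_mod_cast this
    calc c * _ ≤ c * 2 := mul_le_mul_of_nonneg_left h2 hc.le
      _ = 2 * c := mul_comm _ _
  have dsymm : ∀ x y, d x y = d y x := fun x y => by simp only [d, ne_comm]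
  rcases S.eq_empty_or_nonempty with rfl | ⟨p₀, hp₀⟩
  · exact ⟨1, by simp⟩
  have hB0 : 0 ≤ B := (abs_nonneg _).trans (hB p₀ hp₀ 1)
  have hM : 0 ≤ 2 * B / δ := by positivity
  have hex : ∀ p, ∃ g : Equiv.Perm (Fin n) → ℝ, p ∈ S → (∀ x, |g x - φ p x| ≤ ε) ∧
      ∀ x y, g x - g y ≤ 2 * B / δ * d x y := by
    intro p
    by_cases hp : p ∈ S
    · obtain ⟨g, hg⟩ := exists_lipschitz_approx d (fun _ _ => by positivity) (fun _ => by simp [d])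
        dtri (φ p) hδ (hB p hp) hε.le (hφ p hp)
      exact ⟨g, fun _ => hg⟩
    · exact ⟨0, fun h => absurd h hp⟩
  choose g hg using hex
  set N : ℝ := ((Fintype.card (Equiv.Perm (Fin n)) : ℕ) : ℝ) with hN
  have hvar : ∀ p ∈ S, ∑ σ, (g p σ - finMean (g p)) ^ 2 ≤
      N * (n * (2 * (2 * B / δ) * c) ^ 2) := by
    intro p hp
    have h := perm_variance_le (Fin n) (g p) (2 * (2 * B / δ) * c) fun a b σ => by
      have h1 := (hg p hp).2 (Equiv.swap a b * σ) σ
      have h2 := (hg p hp).2 σ (Equiv.swap a b * σ)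
      rw [dsymm] at h2
      have h3 := mul_le_mul_of_nonneg_left (hswap a b σ) hM
      rw [abs_le]
      constructor <;> linarith
    rwa [Fintype.card_fin] at h
  -- Both terms are compared with the mean: `(u - v) ^ 2 ≤ 2 * u ^ 2 + 2 * v ^ 2`, and translation
  -- preserves the variance.
  have hdiff : ∀ p ∈ S, ∑ σ, (g p (τ p * σ) - g p σ) ^ 2 ≤
      N * (4 * (n * (2 * (2 * B / δ) * c) ^ 2)) := by
    intro p hp
    have h1 : ∑ σ, (g p (τ p * σ) - finMean (g p)) ^ 2 = ∑ σ, (g p σ - finMean (g p)) ^ 2 :=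
      Equiv.sum_comp (Equiv.mulLeft (τ p)) fun σ => (g p σ - finMean (g p)) ^ 2
    calc _ ≤ ∑ σ, (2 * (g p (τ p * σ) - finMean (g p)) ^ 2 +
          2 * (g p σ - finMean (g p)) ^ 2) := by
          refine Finset.sum_le_sum fun σ _ => ?_
          nlinarith [sq_nonneg ((g p (τ p * σ) - finMean (g p)) + (g p σ - finMean (g p)))]
      _ = 4 * ∑ σ, (g p σ - finMean (g p)) ^ 2 := by
          rw [Finset.sum_add_distrib, ← Finset.mul_sum, ← Finset.mul_sum, h1]
          ring
      _ ≤ _ := by linarith [hvar p hp]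
  -- Averaging the sum over all of `S` makes one `σ` serve every `p`.
  obtain ⟨σ, -, hσ⟩ : ∃ σ ∈ (Finset.univ : Finset (Equiv.Perm (Fin n))),
      ∑ p ∈ S, (g p (τ p * σ) - g p σ) ^ 2 ≤ ε ^ 2 := by
    refine Finset.exists_le_of_sum_le Finset.univ_nonempty ?_
    rw [Finset.sum_comm]
    refine (Finset.sum_le_sum hdiff).trans ?_
    rw [Finset.sum_const, Finset.sum_const, nsmul_eq_mul, nsmul_eq_mul, Finset.card_univ, ← hN]
    have hN0 : 0 ≤ N := by positivity
    nlinarith [mul_le_mul_of_nonneg_left hn hN0]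
  -- One `ε` comes from the mean-square bound, two from replacing `φ p` by `g p`.
  refine ⟨σ, fun p hp => ?_⟩
  have h1 : (g p (τ p * σ) - g p σ) ^ 2 ≤ ε ^ 2 :=
    (Finset.single_le_sum (f := fun p => (g p (τ p * σ) - g p σ) ^ 2)
      (fun _ _ => sq_nonneg _) hp).trans hσ
  have h2 := abs_le.1 (abs_le_of_sq_le_sq h1 hε.le)
  have h3 := abs_le.1 ((hg p hp).1 (τ p * σ))
  have h4 := abs_le.1 ((hg p hp).1 σ)
  rw [abs_le]
  constructor <;> linarith [h2.1, h2.2, h3.1, h3.2, h4.1, h4.2]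

theorem corollary3p2 {X : Type u} [MeasurableSpace X] [StandardBorelSpace X]
    (μ : Measure X) [SigmaFinite μ] [NullSingletonClass μ] :
    IsExtremelyAmenable.{u, v} (MeasureAut μ) := by
  classical
  intro K _ _ _ _ _ _
  obtain ⟨x₀⟩ := ‹Nonempty K›
  suffices h : ∃ x : K, ∀ g : MeasureAut.pointwiseGroup μ, MeasureAut.mkHom μ g • x = x by
    obtain ⟨x, hx⟩ := h
    refine ⟨x, fun g => ?_⟩
    obtain ⟨T, rfl⟩ := MeasureAut.mkHom_surjective μ g
    exact hx T
  refine exists_fixed_point_of_almost_fixed _ (fun g => continuous_const_smul _) fun S ε hε => ?_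
  have hV : {v : MeasureAut μ | ∀ p ∈ S, ∀ x : K, |p.2 (v • x) - p.2 x| < ε / 4} ∈ nhds 1 :=
    (Filter.eventually_all_finset S).2 fun p _ =>
      eventually_forall_abs_sub_lt p.2 (by positivity)
  obtain ⟨𝒜, δ, hδ, h𝒜, hV'⟩ := MeasureAut.exists_finset_of_mem_nhds_one μ hV
  obtain ⟨C, hC, happrox⟩ := MeasureAut.exists_perm_approx μ (S.image Prod.fst) 𝒜 h𝒜 hδ
  set B : ℝ := ∑ p ∈ S, ‖p.2‖ with hB
  have hB0 : 0 ≤ B := Finset.sum_nonneg fun p _ => norm_nonneg _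
  -- Since `c * n ≤ C`, the smallness condition of the concentration lemma follows from `D * c ≤ (ε
  -- / 4) ^ 2`; `D + 1` below avoids division by zero.
  set D : ℝ := 4 * S.card * (2 * (2 * B / δ)) ^ 2 * C with hD
  have hD0 : 0 ≤ D := by positivity
  obtain ⟨c, n, ρ, hc, hcη, hcn, hmove, hF⟩ := happrox ((ε / 4) ^ 2 / (D + 1)) (by positivity)
  choose τ hτ using fun p : {p // p ∈ S} => hF p.1.1 (Finset.mem_image_of_mem _ p.2)
  obtain ⟨σ, hσ⟩ := exists_perm_almost_invariant (Finset.univ : Finset {p // p ∈ S})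
    (fun p σ => p.1.2 (MeasureAut.mkHom μ (ρ σ) • x₀)) (fun p => (τ p)⁻¹) (B := B) (c := c)
    (δ := δ) (ε := ε / 4) hc hδ (by positivity)
    (fun p _ σ => (p.1.2.norm_coe_le_norm _).trans
      (Finset.single_le_sum (f := fun p => ‖p.2‖) (fun _ _ => norm_nonneg _) p.2))
    (fun p _ σ σ' hd => by
      -- `σ * σ'⁻¹` moves no more points than there are places where `σ` and `σ'` differ.
      have hmem := hV' (ρ (σ * σ'⁻¹)) fun A _ => by
        refine (hmove _ A).trans_lt ((ENNReal.ofReal_lt_ofReal_iff hδ).2 (lt_of_le_of_lt ?_ hd))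
        refine mul_le_mul_of_nonneg_left ?_ hc.le
        norm_cast
        refine Finset.card_le_card_of_injOn (fun i => σ'⁻¹ i) (fun i hi => ?_)
          (σ'⁻¹).injective.injOn
        refine Finset.mem_coe.2 (Finset.mem_filter.2 ⟨Finset.mem_univ _, ?_⟩)
        have h := (Finset.mem_filter.1 (Finset.mem_coe.1 hi)).2
        simpa using h
      have h1 := hmem p.1 p.2 (MeasureAut.mkHom μ (ρ σ') • x₀)
      rw [smul_smul, ← map_mul, ← map_mul, inv_mul_cancel_right] at h1
      exact h1.le)
    (by
      rw [Finset.card_univ, Fintype.card_coe]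
      have h1 : D * c ≤ (ε / 4) ^ 2 := by
        rw [le_div_iff₀ (by positivity)] at hcη
        nlinarith
      have h2 : 0 ≤ 4 * S.card * (2 * (2 * B / δ)) ^ 2 * c := by positivity
      have h3 := mul_le_mul_of_nonneg_left hcn h2
      calc _ = 4 * S.card * (2 * (2 * B / δ)) ^ 2 * c * (c * n) := by ring
        _ ≤ _ := h3
        _ = D * c := by rw [hD]; ring
        _ ≤ _ := h1)
  refine ⟨MeasureAut.mkHom μ (ρ σ) • x₀, fun p hp => ?_⟩
  have h1 := hσ ⟨p, hp⟩ (Finset.mem_univ _)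
  -- The element `g * ρ (τ)` of the neighbourhood sends `ρ (τ⁻¹ * σ) • x₀` to `g • ρ σ • x₀`; this
  -- costs `ε / 4`, and `h1` costs `3 * (ε / 4)`.
  have h2 := hV' _ (hτ ⟨p, hp⟩) p hp (MeasureAut.mkHom μ (ρ ((τ ⟨p, hp⟩)⁻¹ * σ)) • x₀)
  rw [smul_smul, ← map_mul, mul_assoc, ← map_mul ρ, mul_inv_cancel_left, map_mul,
    mul_smul] at h2
  have h3 := abs_sub_le (p.2 (MeasureAut.mkHom μ p.1 • MeasureAut.mkHom μ (ρ σ) • x₀))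
    (p.2 (MeasureAut.mkHom μ (ρ ((τ ⟨p, hp⟩)⁻¹ * σ)) • x₀)) (p.2 (MeasureAut.mkHom μ (ρ σ) • x₀))
  linarith
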